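/- Let $G=(V,E)$ be a finite directed acyclic graph, parallel edges allowed, in which every edge has unit capacity, and let $s_i-t_i$ ($i=1,2,3$) be three source–terminal pairs of nodes of $G$ (nodes of different sessions may coincide). Suppose that the connectivity level is $[1~3~3]$, i.e. the maximum flow in $G$ from $s_1$ to $t_1$ is $1$, from $s_2$ to $t_2$ is $3$, and from $s_3$ to $t_3$ is $3$. Then the multiple unicast instance in which every source has unit rate has a vector linear network coding solution over two time units, over every finite field $F$. Explicitly: there are $2\times 2$ matrices over $F$, namely $K_{e',e}$ for edges $e',e$ with $\mathrm{head}(e')=\mathrm{tail}(e)$, $A_{i,e}$ for $s_i=\mathrm{tail}(e)$, and $D_{i,e}$ for $\mathrm{head}(e)=t_i$, such that for all source vectors $X_1,X_2,X_3\in F^2$ the edge signals $Y_e\in F^2$ determined (uniquely, since $G$ is acyclic) by $$Y_e=\sum_{e':\,\mathrm{head}(e')=\mathrm{tail}(e)}K_{e',e}Y_{e'}+\sum_{i:\,s_i=\mathrm{tail}(e)}A_{i,e}X_i\qquad(e\in E)$$ satisfy $$\sum_{e:\,\mathrm{head}(e)=t_i}D_{i,e}Y_e=X_i\qquad(i=1,2,3).$$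 -/

import Mathlib

/-- A directed acyclic network with unit-capacity edges. The edges form a type of their own, so
parallel edges (several unit-capacity edges from one node to another) are allowed. -/
structure Network (V E : Type*) where
  tail : E → V
  head : E → V
  acyclic : ∀ v, ¬ Relation.TransGen (fun u w => ∃ e, tail e = u ∧ head e = w) v v

namespace Network

variable {V E : Type*} [DecidableEq V] [Fintype E]

/-- Total amount that `f` carries out of `v` minus the total amount that it carries into `v`. -/
def netOut (G : Network V E) (f : E → ℝ) (v : V) : ℝ :=
  (∑ e with G.tail e = v, f e) - ∑ e with G.head e = v, f e

/-- `f` is a flow from `a` to `b` in the network, all of whose edges have capacity `1`. -/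
def IsFlow (G : Network V E) (a b : V) (f : E → ℝ) : Prop :=
  (∀ e, 0 ≤ f e ∧ f e ≤ 1) ∧ ∀ v, v ≠ a → v ≠ b → G.netOut f v = 0

/-- The maximum flow from `a` to `b` exists and has value `c`. -/
def IsMaxFlowValue (G : Network V E) (a b : V) (c : ℝ) : Prop :=
  IsGreatest {x : ℝ | ∃ f, G.IsFlow a b f ∧ G.netOut f a = x} c

/-- The connectivity level of the pairs `s i - t i` is the vector `k`. -/
def HasConnectivityLevel {n : ℕ} (G : Network V E) (s t : Fin n → V) (k : Fin n → ℕ) : Prop :=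
  ∀ i, G.IsMaxFlowValue (s i) (t i) (k i)

/-- In a finite network, "enters the tail of" is a well-founded relation on edges. -/
theorem wellFounded_edge {V E : Type*} [Finite E] (G : Network V E) :
    WellFounded (fun e' e : E => G.head e' = G.tail e) := by
  have key : ∀ e' e, Relation.TransGen (fun e' e : E => G.head e' = G.tail e) e' e →
      Relation.TransGen (fun u w => ∃ e, G.tail e = u ∧ G.head e = w)
        (G.tail e') (G.tail e) := by
    intro e' e h
    induction h with
    | single h => exact .single ⟨e', rfl, h⟩
    | tail _ h ih => exact ih.tail ⟨_, rfl, h⟩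
  have : Std.Irrefl (Relation.TransGen (fun e' e : E => G.head e' = G.tail e)) :=
    ⟨fun e h => G.acyclic _ (key e e h)⟩
  have hw := Finite.wellFounded_of_trans_of_irrefl
    (Relation.TransGen (fun e' e : E => G.head e' = G.tail e))
  exact hw.mono fun _ _ h => .single h

end Network

/-- The coefficients of a vector linear network code over `F` with vector length `T`, for `n`
sessions on a network with edge set `E`: every edge carries a vector of `T` symbols, one for each
of its `T` parallel copies. A coefficient block is used only where it makes sense: `relay e' e` if
`e'` enters the tail of `e`, `inject i e` if the source `i` is located at the tail of `e`, and
`decode i e` if `e` enters the terminal `i`. -/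
structure VectorLinearCode (F E : Type*) (n T : ℕ) where
  relay : E → E → Matrix (Fin T) (Fin T) F
  inject : Fin n → E → Matrix (Fin T) (Fin T) F
  decode : Fin n → E → Matrix (Fin T) (Fin T) F

namespace VectorLinearCode

variable {V E F : Type*} [DecidableEq V] [Fintype E] [Field F] {n T : ℕ}

/-- `Y` are the edge signals that the code `C` produces on `G` when the source `i`, located at the
node `s i`, emits the vector `X i`: the signal on each edge is the prescribed linear combination of
the signals on the edges entering its tail and of the source vectors observed at its tail. -/
def IsSignal (C : VectorLinearCode F E n T) (G : Network V E) (s : Fin n → V)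
    (X : Fin n → Fin T → F) (Y : E → Fin T → F) : Prop :=
  ∀ e, Y e = (∑ e' with G.head e' = G.tail e, (C.relay e' e).mulVec (Y e')) +
    ∑ i with s i = G.tail e, (C.inject i e).mulVec (X i)

/-- Every terminal `t i` recovers the whole vector `X i` from the signals on its incoming edges,
whatever the sources emit. (The signals exist and are unique, see `existsUnique_isSignal`.) -/
def IsSolution (C : VectorLinearCode F E n T) (G : Network V E) (s t : Fin n → V) : Prop :=
  ∀ X : Fin n → Fin T → F, ∃ Y : E → Fin T → F, C.IsSignal G s X Y ∧
    ∀ i, ∑ e with G.head e = t i, (C.decode i e).mulVec (Y e) = X i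

/-- Since the network is acyclic, the source vectors determine the edge signals. -/
theorem existsUnique_isSignal (C : VectorLinearCode F E n T) (G : Network V E) (s : Fin n → V)
    (X : Fin n → Fin T → F) : ∃! Y, C.IsSignal G s X Y := by
  classical
  let step : (e : E) → ((e' : E) → G.head e' = G.tail e → Fin T → F) → Fin T → F := fun e rec =>
    (∑ e' with G.head e' = G.tail e,
      if h : G.head e' = G.tail e then (C.relay e' e).mulVec (rec e' h) else 0) +
      ∑ i with s i = G.tail e, (C.inject i e).mulVec (X i)
  refine ⟨G.wellFounded_edge.fix step, fun e => ?_, fun Y hY => funext fun e => ?_⟩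
  · rw [WellFounded.fix_eq]
    refine congrArg (· + _) (Finset.sum_congr rfl fun e' he' => ?_)
    exact dif_pos (Finset.mem_filter.1 he').2
  · induction e using G.wellFounded_edge.induction with
    | _ e ih =>
      rw [hY e, WellFounded.fix_eq]
      refine congrArg (· + _) (Finset.sum_congr rfl fun e' he' => ?_)
      have h := (Finset.mem_filter.1 he').2
      rw [dif_pos h, ih e' h]

end VectorLinearCode

/-- The multiple unicast instance on `G` with unit-rate sessions `s i - t i` has a vector linear
network coding solution over `F` with vector length `T`. -/
def Network.HasVectorLinearSolution {V E : Type*} [DecidableEq V] [Fintype E] (G : Network V E)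
    (F : Type*) [Field F] {n : ℕ} (s t : Fin n → V) (T : ℕ) : Prop :=
  ∃ C : VectorLinearCode F E n T, C.IsSolution G s t

/-! The two time units are shared. In unit 0, session 1 sends one symbol and session 2 sends two,
while session 3 is silent; in unit 1, sessions 2 and 3 swap roles. It thus suffices to send one
symbol `w` along a walk `P` and two symbols from `a` to `b` along three edge-disjoint walks `Q i`,
which `P` may cross anywhere (`exists_coding_one_two`).

The coding lemma `exists_coding` lets `P` merge with each `Q i` that it joins. If these are joined
in the order `L`, then `b` receives `w` plus each nonempty partial sum of the `q i` along `L`, as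
well as each `q i` with `i` outside `L`, and the end of `P` receives `w` plus the full sum. Since
`L` depends on the walks alone, the `q i` may be chosen afterwards with full sum zero, at the cost
of one of three symbols. Then `w` arrives intact, and differences of partial sums give `b` every `q
i`. Only sums and differences occur, so any field will do.

The disjoint walks come from a real flow: return edges turn it into a circulation, and Birkhoff's
theorem extracts an integral one as a permutation of the edges (`exists_perm_of_circulation`). -/

namespace Network

variable {V E : Type*}

/-- The edges in the list `l` form a directed walk from `a` to `b`. -/
def IsWalk (G : Network V E) : V → V → List E → Prop
  | a, b, [] => a = b
  | a, b, e :: l => G.tail e = a ∧ IsWalk G (G.head e) b l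

theorem isWalk_append {G : Network V E} {a b : V} {l₁ l₂ : List E} :
    G.IsWalk a b (l₁ ++ l₂) ↔ ∃ c, G.IsWalk a c l₁ ∧ G.IsWalk c b l₂ := by
  induction l₁ generalizing a with
  | nil => simp [IsWalk]
  | cons e l ih => simp [IsWalk, ih, and_assoc]

theorem IsWalk.transGen {G : Network V E} {a b : V} {l : List E} (h : G.IsWalk a b l)
    (hl : l ≠ []) : Relation.TransGen (fun u w => ∃ e, G.tail e = u ∧ G.head e = w) a b := by
  induction l generalizing a with
  | nil => exact absurd rfl hl
  | cons e l ih =>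
    obtain ⟨he, hw⟩ := h
    by_cases hl' : l = []
    · subst hl'
      exact .single ⟨e, he, hw⟩
    · exact .head ⟨e, he, rfl⟩ (ih hw hl')

theorem IsWalk.eq_nil {G : Network V E} {a : V} {l : List E} (h : G.IsWalk a a l) : l = [] := by
  by_contra hl
  exact G.acyclic a (h.transGen hl)

/-- A repeated edge would close a nonempty walk, against acyclicity. -/
theorem IsWalk.nodup {G : Network V E} {a b : V} {l : List E} (h : G.IsWalk a b l) :
    l.Nodup := by
  induction l generalizing a with
  | nil => exact List.nodup_nil
  | cons e l ih =>
    refine List.nodup_cons.2 ⟨fun he => ?_, ih h.2⟩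
    obtain ⟨l₁, l₂, rfl⟩ := List.append_of_mem he
    obtain ⟨c, h₁, h₂⟩ := isWalk_append.1 h.2
    have : G.IsWalk (G.tail e) (G.tail e) (e :: l₁) := ⟨rfl, h₂.1 ▸ h₁⟩
    exact List.cons_ne_nil _ _ this.eq_nil

/-- The last edge of a nonempty walk enters the final node. -/
theorem IsWalk.exists_head_eq {G : Network V E} {a b : V} {l : List E} (h : G.IsWalk a b l)
    (hl : l ≠ []) : ∃ e ∈ l, G.head e = b := by
  induction l generalizing a with
  | nil => exact absurd rfl hl
  | cons e l ih =>
    by_cases hl' : l = []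
    · subst hl'
      exact ⟨e, by simp, h.2⟩
    · obtain ⟨e', he', hb⟩ := ih h.2 hl'
      exact ⟨e', List.mem_cons_of_mem _ he', hb⟩

/-! ### Coding along a walk that crosses disjoint walks -/

variable {F W : Type*} [Field F] [AddCommGroup W] [Module F W]

/-- The global coding vectors that arrive at the node `v` span this space. -/
def received (F : Type*) {W : Type*} [Field F] [AddCommGroup W] [Module F W]
    (G : Network V E) (g : E → W) (v : V) : Submodule F W :=
  Submodule.span F (g '' {e | G.head e = v})

theorem mem_received {G : Network V E} (g : E → W) (e : E) : g e ∈ G.received F g (G.head e) :=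
  Submodule.subset_span ⟨e, rfl, rfl⟩

/-- A vector that is available at the start of a walk and is forwarded along it is available at
the tail of each edge and at the end. -/
theorem IsWalk.mem_received_sup {G : Network V E} {a b : V} {l : List E} (h : G.IsWalk a b l)
    {g : E → W} {w : W} (hg : ∀ e ∈ l, g e = w) {src : V → Submodule F W}
    (ha : w ∈ G.received F g a ⊔ src a) :
    (∀ e ∈ l, w ∈ G.received F g (G.tail e) ⊔ src (G.tail e)) ∧
      w ∈ G.received F g b ⊔ src b := by
  induction l generalizing a with
  | nil => exact ⟨by simp, (show a = b from h) ▸ ha⟩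
  | cons e l ih =>
    have hw : w ∈ G.received F g (G.head e) ⊔ src (G.head e) :=
      Submodule.mem_sup_left (hg e (by simp) ▸ mem_received g e)
    have := ih h.2 (fun e' he' => hg e' (List.mem_cons_of_mem _ he')) hw
    refine ⟨fun e' he' => ?_, this.2⟩
    rcases List.mem_cons.1 he' with rfl | he'
    · rw [h.1]; exact ha
    · exact this.1 e' he'

theorem IsWalk.mem_received {G : Network V E} {a b : V} {l : List E} (h : G.IsWalk a b l)
    (hl : l ≠ []) {g : E → W} {w : W} (hg : ∀ e ∈ l, g e = w) : w ∈ G.received F g b := by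
  obtain ⟨e, he, rfl⟩ := h.exists_head_eq hl
  exact hg e he ▸ Network.mem_received g e

/-- Splitting a list at the first element that satisfies a predicate. -/
theorem _root_.List.exists_eq_append_cons_of_exists {α : Type*} {p : α → Prop} {l : List α}
    (h : ∃ x ∈ l, p x) : ∃ l₁ x l₂, l = l₁ ++ x :: l₂ ∧ p x ∧ ∀ y ∈ l₁, ¬ p y := by
  induction l with
  | nil => simp at h
  | cons y l ih =>
    by_cases hy : p y
    · exact ⟨[], y, l, rfl, hy, by simp⟩
    · obtain ⟨l₁, x, l₂, rfl, hx, hl⟩ := ih (by simpa [hy] using h)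
      exact ⟨y :: l₁, x, l₂, rfl, hx, by simpa [hy] using hl⟩

/-- Splitting a list at the last element that satisfies a predicate. -/
theorem _root_.List.exists_eq_append_cons_of_exists' {α : Type*} {p : α → Prop} {l : List α}
    (h : ∃ x ∈ l, p x) : ∃ l₁ x l₂, l = l₁ ++ x :: l₂ ∧ p x ∧ ∀ y ∈ l₂, ¬ p y := by
  obtain ⟨l₁, x, l₂, hl, hx, hy⟩ := List.exists_eq_append_cons_of_exists (p := p) (l := l.reverse)
    (by simpa using h)
  refine ⟨l₂.reverse, x, l₁.reverse, ?_, hx, by simpa using hy⟩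
  rw [← List.reverse_reverse l, hl]
  simp

/-- The vectors that are emitted at the node `v` when `w` is emitted at `x` and all `q i` at `a`. -/
def emitted (F : Type*) {W ι : Type*} [Field F] [AddCommGroup W] [Module F W]
    (x a : V) (w : W) (q : ι → W) (v : V) : Submodule F W :=
  Submodule.span F {y | (v = x ∧ y = w) ∨ (v = a ∧ y ∈ Set.range q)}

/-- A walk `P` from `x` to `y` and edge-disjoint walks `Q i` from `a` to `b` carry the vectors
`w` and `q i` together: whenever `P` meets a new walk `Q i`, both proceed with the sum of their
vectors, and `P` leaves `Q i` at the last edge that they share. Here `L` lists the walks `Q i` in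
the order in which they are met. -/
theorem exists_coding (G : Network V E) {ι : Type*} {a b y : V} {Q : ι → List E}
    (hQ : ∀ i, G.IsWalk a b (Q i)) (hne : ∀ i, Q i ≠ [])
    (hdisj : ∀ i j, i ≠ j → (Q i).Disjoint (Q j)) (S : Finset ι) :
    ∀ x P, G.IsWalk x y P → ∃ L : List ι, L.Nodup ∧ (∀ i ∈ L, i ∈ S) ∧
      ∀ (w : W) (q : ι → W), ∃ g : E → W,
        (∀ e, g e ≠ 0 → e ∈ P ∨ ∃ i ∈ S, e ∈ Q i) ∧
        (∀ e, g e ∈ G.received F g (G.tail e) ⊔ emitted F x a w q (G.tail e)) ∧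
        ((P = [] ∧ L = []) ∨ w + (L.map q).sum ∈ G.received F g y) ∧
        (∀ i ∈ S, i ∉ L → q i ∈ G.received F g b) ∧
        ∀ L₁, L₁ <+: L → L₁ ≠ [] → w + (L₁.map q).sum ∈ G.received F g b := by
  classical
  induction S using Finset.strongInduction with
  | H S ih =>
  intro x P hP
  by_cases hmeet : ∃ e ∈ P, ∃ i ∈ S, e ∈ Q i
  · obtain ⟨A, c₁, P₂, rfl, ⟨i, hi, hc₁⟩, hA⟩ := List.exists_eq_append_cons_of_exists hmeet
    obtain ⟨M, c₂, B, hM, hc₂, hB⟩ := List.exists_eq_append_cons_of_exists'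
      (p := fun e => e ∈ Q i) (l := c₁ :: P₂) ⟨c₁, by simp, hc₁⟩
    obtain ⟨C, D, hCD⟩ := List.append_of_mem hc₁
    obtain ⟨z, hwA, hwP₂⟩ := isWalk_append.1 hP
    have hz : G.tail c₁ = z := hwP₂.1
    subst hz
    have hwM := hwP₂
    rw [hM, isWalk_append] at hwM
    obtain ⟨z', hwM, hz', hwB⟩ := hwM
    have hQi := hQ i
    rw [hCD, isWalk_append] at hQi
    obtain ⟨z'', hwC, hwD⟩ := hQi
    have hz : G.tail c₁ = z'' := hwD.1
    subst hz
    have hPnd := hP.nodup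
    rw [hM] at hPnd
    have hQnd := (hQ i).nodup
    rw [hCD] at hQnd
    have hCQ : ∀ e ∈ C, e ∈ Q i := fun e he => by rw [hCD]; simp [he]
    have hDQ : ∀ e ∈ c₁ :: D, e ∈ Q i := fun e he => by
      rw [hCD]; exact List.mem_append_right _ he
    -- If `c₂` preceded `c₁` on `Q i`, following `P` from `c₁` to `c₂` and then `Q i` back to `c₁`
    -- would be a cycle.
    have hc₂D : c₂ ∈ c₁ :: D := by
      rw [hCD, List.mem_append] at hc₂
      refine hc₂.resolve_left fun hc => ?_
      obtain ⟨C₁, C₂, rfl⟩ := List.append_of_mem hc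
      obtain ⟨u, -, hu⟩ := isWalk_append.1 hwC
      have hloop : G.IsWalk (G.tail c₁) (G.tail c₁) (M ++ c₂ :: C₂) :=
        isWalk_append.2 ⟨z', hwM, hz', hu.2⟩
      simpa using hloop.eq_nil
    -- The rest `B` of `P` avoids `Q i`, so the induction applies to it without `i`, with `w + q i`
    -- in the role of `w`.
    obtain ⟨L, hLnd, hLS, hL⟩ := ih (S.erase i) (Finset.erase_ssubset hi) _ B hwB
    have hiL : i ∉ L := fun h => by simpa using hLS i h
    refine ⟨i :: L, List.nodup_cons.2 ⟨hiL, hLnd⟩, ?_, fun w q => ?_⟩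
    · simp only [List.mem_cons, forall_eq_or_imp]
      exact ⟨hi, fun j hj => Finset.mem_of_mem_erase (hLS j hj)⟩
    obtain ⟨g', hsupp, hval, hy, hb, hpre⟩ := hL (w + q i) q
    have hAi : ∀ e ∈ A, e ∉ Q i := fun e he h => hA e he ⟨i, hi, h⟩
    -- `g'` vanishes on all edges that `g` overwrites, so nothing received under `g'` is lost.
    have hzQ : ∀ e ∈ Q i, g' e = 0 := fun e he => by
      by_contra h
      rcases hsupp e h with h | ⟨j, hj, h⟩
      · exact hB e h he
      · exact hdisj j i (Finset.ne_of_mem_erase hj) h he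
    have hzA : ∀ e ∈ A, g' e = 0 := fun e he => by
      by_contra h
      rcases hsupp e h with h | ⟨j, hj, h⟩
      · refine (List.nodup_append.1 hPnd).2.2 e he e ?_ rfl
        simp [h]
      · exact hA e he ⟨j, Finset.mem_of_mem_erase hj, h⟩
    -- From `c₁` to `c₂` the sum travels along `Q i`; the edges of `P` in between that are off `Q i`
    -- are bypassed and keep the value of `g'`.
    let g : E → W := fun e => if e ∈ A then w else if e ∈ C then q i else
      if e ∈ c₁ :: D then w + q i else g' e
    have hgA : ∀ e ∈ A, g e = w := fun e he => if_pos he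
    have hgC : ∀ e ∈ C, g e = q i := fun e he => by
      simp only [g]
      rw [if_neg fun h => hAi e h (hCQ e he), if_pos he]
    have hgD : ∀ e ∈ c₁ :: D, g e = w + q i := fun e he => by
      simp only [g]
      rw [if_neg fun h => hAi e h (hDQ e he),
        if_neg fun h => (List.nodup_append.1 hQnd).2.2 e h e he rfl, if_pos he]
    have hgg' : ∀ e, g' e ≠ 0 → g e = g' e := fun e he => by
      simp only [g]
      rw [if_neg fun h => he (hzA e h), if_neg fun h => he (hzQ e (hCQ e h)),
        if_neg fun h => he (hzQ e (hDQ e h))]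
    have hle : ∀ v, G.received F g' v ≤ G.received F g v := fun v => by
      refine Submodule.span_le.2 ?_
      rintro _ ⟨e, he, rfl⟩
      by_cases h : g' e = 0
      · rw [h]; exact Submodule.zero_mem _
      · rw [← hgg' e h]; exact Submodule.subset_span ⟨e, he, rfl⟩
    have hwx : w ∈ G.received F g x ⊔ emitted F x a w q x :=
      Submodule.mem_sup_right (Submodule.subset_span (.inl ⟨rfl, rfl⟩))
    have hqa : q i ∈ G.received F g a ⊔ emitted F x a w q a :=
      Submodule.mem_sup_right (Submodule.subset_span (.inr ⟨rfl, i, rfl⟩))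
    have hvA := hwA.mem_received_sup hgA hwx
    have hvC := hwC.mem_received_sup hgC hqa
    have hvD := hwD.mem_received_sup hgD (Submodule.add_mem _ hvA.2 hvC.2)
    have hwqb : w + q i ∈ G.received F g b := hwD.mem_received (List.cons_ne_nil _ _) hgD
    refine ⟨g, fun e he => ?_, fun e => ?_, .inr ?_, fun j hj hjL => ?_, fun L₁ hL₁ hL₁ne => ?_⟩
    · by_cases h₁ : e ∈ A
      · exact .inl (by simp [h₁])
      by_cases h₂ : e ∈ Q i
      · exact .inr ⟨i, hi, h₂⟩
      have : g e = g' e := by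
        simp only [g]
        rw [if_neg h₁, if_neg fun h => h₂ (hCQ e h), if_neg fun h => h₂ (hDQ e h)]
      rw [this] at he
      rcases hsupp e he with h | ⟨j, hj, h⟩
      · exact .inl (by rw [hM]; simp [h])
      · exact .inr ⟨j, Finset.mem_of_mem_erase hj, h⟩
    · by_cases h₁ : e ∈ A
      · rw [hgA e h₁]; exact hvA.1 e h₁
      by_cases h₂ : e ∈ C
      · rw [hgC e h₂]; exact hvC.1 e h₂
      by_cases h₃ : e ∈ c₁ :: D
      · rw [hgD e h₃]; exact hvD.1 e h₃
      have : g e = g' e := by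
        simp only [g]
        rw [if_neg h₁, if_neg h₂, if_neg h₃]
      rw [this]
      refine (sup_le ((hle _).trans le_sup_left) ?_) (hval e)
      refine Submodule.span_le.2 ?_
      rintro u (⟨hv, rfl⟩ | ⟨hv, hu⟩)
      -- The vector that `g'` takes as emitted where `B` starts is delivered there by `c₂`.
      · refine Submodule.mem_sup_left ?_
        rw [hv, ← hgD c₂ hc₂D]
        exact Network.mem_received g c₂
      · exact Submodule.mem_sup_right (Submodule.subset_span (.inr ⟨hv, hu⟩))
    · rw [List.map_cons, List.sum_cons, ← add_assoc]
      -- If `B` is empty, `c₂` itself enters `y`.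
      rcases hy with ⟨rfl, rfl⟩ | hy
      · have hhead : G.head c₂ = y := hwB
        rw [List.map_nil, List.sum_nil, add_zero, ← hgD c₂ hc₂D, ← hhead]
        exact Network.mem_received g c₂
      · exact hle _ hy
    · rw [List.mem_cons, not_or] at hjL
      exact hle _ (hb j (Finset.mem_erase.2 ⟨hjL.1, hj⟩) hjL.2)
    · obtain ⟨j, L₂, rfl⟩ := List.exists_cons_of_ne_nil hL₁ne
      obtain ⟨rfl, hL₂⟩ := List.cons_prefix_cons.1 hL₁
      rw [List.map_cons, List.sum_cons, ← add_assoc]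
      by_cases h : L₂ = []
      · subst h
        simpa using hwqb
      · exact hle _ (hpre L₂ hL₂ h)
  · have hPQ : ∀ i ∈ S, ∀ e ∈ Q i, e ∉ P := fun i hi e he hP => hmeet ⟨e, hP, i, hi, he⟩
    refine ⟨[], List.nodup_nil, by simp, fun w q => ?_⟩
    let g : E → W := fun e => if e ∈ P then w else
      if h : ∃ i ∈ S, e ∈ Q i then q h.choose else 0
    have hgP : ∀ e ∈ P, g e = w := fun e he => if_pos he
    have hgQ : ∀ i ∈ S, ∀ e ∈ Q i, g e = q i := fun i hi e he => by
      have h : ∃ i ∈ S, e ∈ Q i := ⟨i, hi, he⟩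
      simp only [g]
      rw [if_neg (hPQ i hi e he), dif_pos h]
      by_contra hne
      exact hdisj h.choose i (fun h' => hne (by rw [h'])) h.choose_spec.2 he
    have hwx : w ∈ G.received F g x ⊔ emitted F x a w q x :=
      Submodule.mem_sup_right (Submodule.subset_span (.inl ⟨rfl, rfl⟩))
    have hqa : ∀ i, q i ∈ G.received F g a ⊔ emitted F x a w q a := fun i =>
      Submodule.mem_sup_right (Submodule.subset_span (.inr ⟨rfl, i, rfl⟩))
    refine ⟨g, fun e he => ?_, fun e => ?_, ?_, fun j hj _ => ?_, fun L₁ hL₁ hL₁ne => ?_⟩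
    · by_contra h
      rw [not_or] at h
      refine he ?_
      simp only [g]
      rw [if_neg h.1, dif_neg h.2]
    · by_cases h₁ : e ∈ P
      · rw [hgP e h₁]; exact (hP.mem_received_sup hgP hwx).1 e h₁
      by_cases h₂ : ∃ i ∈ S, e ∈ Q i
      · obtain ⟨i, hi, he⟩ := h₂
        rw [hgQ i hi e he]
        exact ((hQ i).mem_received_sup (hgQ i hi) (hqa i)).1 e he
      have : g e = 0 := by
        simp only [g]
        rw [if_neg h₁, dif_neg h₂]
      rw [this]; exact Submodule.zero_mem _
    · by_cases h : P = []
      · exact .inl ⟨h, rfl⟩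
      · exact .inr (by simpa using hP.mem_received h hgP)
    · exact (hQ j).mem_received (hne j) (hgQ j hj)
    · exact absurd (List.prefix_nil.1 hL₁) hL₁ne

end Network

/-! ### Edge-disjoint walks from a real flow -/

/-- A circulation with capacities `1` contains an integral one, given as a permutation that fixes
the unused edges and maps every used edge to its successor. -/
theorem exists_perm_of_circulation {V X : Type*} [DecidableEq V] [Fintype X]
    (tail head : X → V) (f : X → ℝ) (h₀ : ∀ x, 0 ≤ f x) (h₁ : ∀ x, f x ≤ 1)
    (hf : ∀ v, ∑ x with tail x = v, f x = ∑ x with head x = v, f x) :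
    ∃ σ : Equiv.Perm X, ∀ x, (σ x = x ∧ f x < 1) ∨ head x = tail (σ x) := by
  classical
  let c : V → ℝ := fun v => ∑ x with head x = v, f x
  have hc₀ : ∀ v, 0 ≤ c v := fun v => Finset.sum_nonneg fun x _ => h₀ x
  have hz : ∀ v, c v = 0 → ∀ x, head x = v → f x = 0 := fun v hv x hx =>
    (Finset.sum_eq_zero_iff_of_nonneg fun x _ => h₀ x).1 hv x (by simp [hx])
  have hz' : ∀ v, c v = 0 → ∀ x, tail x = v → f x = 0 := fun v hv x hx =>
    (Finset.sum_eq_zero_iff_of_nonneg fun x _ => h₀ x).1 ((hf v).trans hv) x (by simp [hx])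
  -- A Markov chain on edges: `x` stays put with probability `1 - f x` and otherwise moves to a
  -- successor `y` with probability proportional to `f y`. Where `c` is zero so is `f`, and the
  -- division by zero is harmless.
  let M : Matrix X X ℝ := fun x y => (if x = y then 1 - f x else 0) +
    if head x = tail y then f x * f y / c (head x) else 0
  have hM : M ∈ doublyStochastic ℝ X := by
    rw [mem_doublyStochastic_iff_sum]
    refine ⟨fun x y => ?_, fun x => ?_, fun y => ?_⟩
    · refine add_nonneg ?_ ?_
      · split_ifs
        · exact sub_nonneg.2 (h₁ x)
        · exact le_rfl
      · split_ifs
        · exact div_nonneg (mul_nonneg (h₀ x) (h₀ y)) (hc₀ _)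
        · exact le_rfl
    · simp only [M]
      rw [Finset.sum_add_distrib, Finset.sum_ite_eq, if_pos (Finset.mem_univ x),
        ← Finset.sum_filter, ← Finset.sum_div, ← Finset.mul_sum]
      have : ∑ y with head x = tail y, f y = c (head x) := by
        rw [← show _ = c (head x) from hf (head x)]
        simp only [eq_comm]
      rw [this]
      by_cases h : c (head x) = 0
      · simp [hz _ h x rfl]
      · rw [mul_div_cancel_right₀ _ h]; ring
    · simp only [M]
      rw [Finset.sum_add_distrib, Finset.sum_ite_eq', if_pos (Finset.mem_univ y),
        ← Finset.sum_filter]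
      have : ∑ x with head x = tail y, f x * f y / c (head x) = c (tail y) * f y / c (tail y) := by
        rw [show c (tail y) * f y / c (tail y) =
          (∑ x with head x = tail y, f x) * f y / c (tail y) from rfl, Finset.sum_mul,
          Finset.sum_div]
        exact Finset.sum_congr rfl fun x hx => by rw [(Finset.mem_filter.1 hx).2]
      rw [this]
      by_cases h : c (tail y) = 0
      · simp [hz' _ h y rfl]
      · rw [mul_div_cancel_left₀ _ h]; ring
  -- By Birkhoff's theorem, a permutation of nonzero weight uses only nonzero entries of `M`.
  obtain ⟨w, hw₀, hw₁, hw⟩ := exists_eq_sum_perm_of_mem_doublyStochastic hM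
  obtain ⟨σ, -, hσ⟩ := Finset.exists_ne_zero_of_sum_ne_zero (hw₁.trans_ne one_ne_zero)
  refine ⟨σ, fun x => ?_⟩
  have hpos : M x (σ x) ≠ 0 := by
    refine ne_of_gt (((hw₀ σ).lt_of_ne' hσ).trans_le ?_)
    rw [← hw, Matrix.sum_apply]
    have := Finset.single_le_sum (s := Finset.univ)
      (f := fun τ : Equiv.Perm X => (w τ • τ.permMatrix ℝ) x (σ x)) (fun τ _ => ?_)
      (Finset.mem_univ σ)
    · simpa [Equiv.Perm.permMatrix, PEquiv.toMatrix_apply] using this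
    · simp only [Matrix.smul_apply, smul_eq_mul, Equiv.Perm.permMatrix, PEquiv.toMatrix_apply]
      refine mul_nonneg (hw₀ τ) ?_
      split_ifs <;> norm_num
  by_contra h
  rw [not_or, not_and, not_lt] at h
  refine hpos ?_
  simp only [M]
  rw [if_neg h.2, add_zero]
  split_ifs with hx
  · exact sub_eq_zero.2 (le_antisymm (h.1 hx.symm) (h₁ x))
  · rfl

namespace Network

variable {V E : Type*}

theorem isWalk_map_range {G : Network V E} {a : V} (p : ℕ → E) (n : ℕ) (h₀ : G.tail (p 0) = a)
    (h : ∀ i < n, G.head (p i) = G.tail (p (i + 1))) :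
    G.IsWalk a (G.head (p n)) ((List.range (n + 1)).map p) := by
  induction n with
  | zero => simp [IsWalk, h₀]
  | succ n ih =>
    rw [List.range_succ, List.map_append, isWalk_append]
    exact ⟨_, ih fun i hi => h i (by omega), (h n (by omega)).symm, rfl⟩

variable [DecidableEq V] [Fintype E]

theorem sum_netOut [Fintype V] (G : Network V E) (f : E → ℝ) : ∑ v, G.netOut f v = 0 := by
  simp only [netOut]
  rw [Finset.sum_sub_distrib, Finset.sum_fiberwise, Finset.sum_fiberwise, sub_self]

/-- A flow of integral value `k` yields `k` edge-disjoint walks. -/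
theorem exists_disjoint_walks [Fintype V] (G : Network V E) {a b : V} (hab : a ≠ b) {f : E → ℝ}
    (hf : G.IsFlow a b f) {k : ℕ} (hk : G.netOut f a = k) :
    ∃ Q : Fin k → List E, (∀ i, G.IsWalk a b (Q i)) ∧
      ∀ i j, i ≠ j → (Q i).Disjoint (Q j) := by
  classical
  have hb : G.netOut f b = -k := by
    have h := G.sum_netOut f
    rw [← Finset.sum_subset (Finset.subset_univ {a, b}) (fun v _ hv => by
      simp only [Finset.mem_insert, Finset.mem_singleton, not_or] at hv
      exact hf.2 v hv.1 hv.2), Finset.sum_pair hab, hk] at h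
    linarith
  -- Adding `k` saturated return edges from `b` to `a` makes the flow a circulation.
  let tl : E ⊕ Fin k → V := Sum.elim G.tail fun _ => b
  let hd : E ⊕ Fin k → V := Sum.elim G.head fun _ => a
  obtain ⟨σ, hσ⟩ := exists_perm_of_circulation tl hd (Sum.elim f fun _ => 1)
    (Sum.forall.2 ⟨fun e => (hf.1 e).1, fun _ => zero_le_one⟩)
    (Sum.forall.2 ⟨fun e => (hf.1 e).2, fun _ => le_rfl⟩) (by
      intro v
      rw [Finset.sum_filter, Finset.sum_filter, Fintype.sum_sum_type, Fintype.sum_sum_type]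
      change (∑ e, if G.tail e = v then f e else 0) + (∑ _ : Fin k, if b = v then (1 : ℝ) else 0) =
        (∑ e, if G.head e = v then f e else 0) + ∑ _ : Fin k, if a = v then (1 : ℝ) else 0
      have hv : G.netOut f v = (if a = v then (k : ℝ) else 0) - if b = v then (k : ℝ) else 0 := by
        by_cases h₁ : a = v
        · subst h₁; simp [hk, hab.symm]
        by_cases h₂ : b = v
        · subst h₂; simp [hb, hab]
        rw [hf.2 v (Ne.symm h₁) (Ne.symm h₂)]; simp [h₁, h₂]
      simp only [netOut, Finset.sum_filter] at hv
      simp only [Finset.sum_const, Finset.card_univ, Fintype.card_fin, nsmul_eq_mul]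
      split_ifs at hv ⊢ <;> linarith)
  have hne : ∀ i n, hd ((σ ^ n) (.inr i)) = tl ((σ ^ (n + 1)) (.inr i)) := by
    intro i n
    have hs : (σ ^ (n + 1)) (.inr i) = σ ((σ ^ n) (.inr i)) := by rw [pow_succ']; rfl
    rw [hs]
    -- A fixed point in the orbit of a return edge would be that edge itself, whose flow is `1`, not
    -- less.
    refine (hσ _).resolve_left fun h => ?_
    have hfix : σ (.inr i) = .inr i := by
      have := h.1
      rw [← hs, pow_succ] at this
      exact (σ ^ n).injective this
    rw [Function.IsFixedPt.perm_pow hfix] at h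
    simp at h
  have hper : ∀ i, ∃ n, ((σ ^ (n + 1)) (.inr i)).isRight = true := fun i =>
    ⟨orderOf σ - 1, by rw [Nat.sub_add_cancel (orderOf_pos σ), pow_orderOf_eq_one]; rfl⟩
  -- The orbit of return edge `i` runs through exactly `N i` edges of the network before it meets a
  -- return edge again.
  let N : Fin k → ℕ := fun i => Nat.find (hper i)
  have hN : ∀ i, ((σ ^ (N i + 1)) (.inr i)).isRight = true := fun i => Nat.find_spec (hper i)
  have hlt : ∀ i n, n < N i → ∃ e, (σ ^ (n + 1)) (.inr i) = .inl e := fun i n hn =>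
    Sum.isLeft_iff.1 (by simpa using Nat.find_min (hper i) hn)
  have hN₀ : ∀ i, 0 < N i := fun i => by
    refine Nat.pos_of_ne_zero fun h => hab ?_
    obtain ⟨j, hj⟩ := Sum.isRight_iff.1 (hN i)
    have := hne i 0
    rw [h] at hj
    rw [hj] at this
    exact this
  obtain ⟨e₀⟩ : Nonempty (Fin k → E) := ⟨fun i => (hlt i 0 (hN₀ i)).choose⟩
  have hp : ∀ i n, ∃ e, n < N i → (σ ^ (n + 1)) (.inr i) = .inl e := fun i n => by
    by_cases h : n < N i
    · obtain ⟨e, he⟩ := hlt i n h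
      exact ⟨e, fun _ => he⟩
    · exact ⟨e₀ i, fun h' => absurd h' h⟩
  choose p hp using hp
  refine ⟨fun i => (List.range (N i)).map (p i), fun i => ?_, fun i j hij => ?_⟩
  · obtain ⟨m, hm⟩ := Nat.exists_eq_succ_of_ne_zero (hN₀ i).ne'
    obtain ⟨j, hj⟩ := Sum.isRight_iff.1 (hN i)
    have h₀ := hne i 0
    rw [hp i 0 (hN₀ i)] at h₀
    have hw := isWalk_map_range (G := G) (a := a) (p i) m h₀.symm fun l hl => by
      have := hne i (l + 1)
      rw [hp i l (by omega), hp i (l + 1) (by omega)] at this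
      exact this
    have hlast := hne i (m + 1)
    rw [hp i m (by omega), ← Nat.succ_eq_add_one m, ← hm, hj] at hlast
    have hlast' : G.head (p i m) = b := hlast
    rw [hlast'] at hw
    simpa only [hm] using hw
  -- Cancelling `n + 1` steps leaves return edge `i` on the orbit of `j` after `m - n` steps;
  -- minimality of `N j` forces `m = n`.
  · have key : ∀ i j, ∀ n < N i, ∀ m < N j, n ≤ m → p i n = p j m → i = j := by
      intro i j n hn m hm hnm h
      have h₁ := hp i n hn
      rw [h, ← hp j m hm, show m + 1 = (n + 1) + (m - n) by omega, pow_add σ (n + 1) (m - n)] at h₁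
      have h₂ := (σ ^ (n + 1)).injective h₁
      rcases Nat.eq_zero_or_eq_succ_pred (m - n) with h₀ | h₀
      · rw [h₀] at h₂
        simpa using h₂
      · obtain ⟨e, he⟩ := hlt j (m - n).pred (by omega)
        rw [← Nat.succ_eq_add_one, ← h₀, ← h₂] at he
        simp at he
    intro e hi hj
    obtain ⟨n, hn, rfl⟩ := List.mem_map.1 hi
    obtain ⟨m, hm, h⟩ := List.mem_map.1 hj
    rw [List.mem_range] at hn hm
    rcases le_total n m with hnm | hnm
    · exact hij (key i j n hn m hm hnm h.symm)
    · exact hij (key j i m hm n hn hnm h).symm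

/-- Net outflows sum to zero, so a nonzero value forces `a ≠ b` and the walks are nonempty. -/
theorem IsMaxFlowValue.exists_disjoint_walks [Fintype V] {G : Network V E} {a b : V} {k : ℕ}
    (h : G.IsMaxFlowValue a b k) (hk : k ≠ 0) :
    ∃ Q : Fin k → List E, (∀ i, G.IsWalk a b (Q i)) ∧ (∀ i, Q i ≠ []) ∧
      ∀ i j, i ≠ j → (Q i).Disjoint (Q j) := by
  obtain ⟨f, hf, hfk⟩ := h.1
  have hab : a ≠ b := by
    rintro rfl
    have h := G.sum_netOut f
    rw [Finset.sum_eq_single a (fun v _ hv => hf.2 v hv hv) (by simp), hfk] at h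
    exact hk (Nat.cast_eq_zero.1 h)
  obtain ⟨Q, hQ, hdisj⟩ := G.exists_disjoint_walks hab hf hfk
  refine ⟨Q, hQ, fun i hi => hab ?_, hdisj⟩
  have := hQ i
  rw [hi] at this
  exact this

end Network

namespace Network

variable {V E : Type*} {F W : Type*} [Field F] [AddCommGroup W] [Module F W]

/-- Along a walk from `x` to `y` and three edge-disjoint walks from `a` to `b`, one symbol `w` can be
sent from `x` to `y` and two symbols `u₁`, `u₂` from `a` to `b`. -/
theorem exists_coding_one_two (G : Network V E) {x y a b : V} {P : List E} (hP : G.IsWalk x y P)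
    (hPne : P ≠ []) {Q : Fin 3 → List E} (hQ : ∀ i, G.IsWalk a b (Q i)) (hne : ∀ i, Q i ≠ [])
    (hdisj : ∀ i j, i ≠ j → (Q i).Disjoint (Q j)) (w u₁ u₂ : W) :
    ∃ g : E → W,
      (∀ e, g e ∈ G.received F g (G.tail e) ⊔
        Submodule.span F {z | (G.tail e = x ∧ z = w) ∨ (G.tail e = a ∧ (z = u₁ ∨ z = u₂))}) ∧
      w ∈ G.received F g y ∧ u₁ ∈ G.received F g b ∧ u₂ ∈ G.received F g b := by
  obtain ⟨L, hnd, -, hL⟩ := exists_coding (F := F) (W := W) G hQ hne hdisj Finset.univ x P hP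
  obtain ⟨q, hq, ⟨i₁, hi₁⟩, ⟨i₂, hi₂⟩, hq0⟩ : ∃ q : Fin 3 → W,
      (∀ i, q i ∈ Submodule.span F {z | z = u₁ ∨ z = u₂}) ∧ (∃ i, q i = u₁) ∧
      (∃ i, q i = u₂) ∧ (L.map q).sum = 0 := by
    -- The sacrificed walk `i` must lie in `L`, so that `q i` can cancel the other terms; if `L` is
    -- empty, any choice works.
    obtain ⟨i, j, k, hij, hik, hjk, hi⟩ : ∃ i j k : Fin 3, i ≠ j ∧ i ≠ k ∧ j ≠ k ∧
        (L = [] ∨ i ∈ L) := by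
      rcases L with _ | ⟨i, L⟩
      · exact ⟨0, 1, 2, by simp⟩
      · refine ⟨i, i + 1, i + 2, ?_, ?_, ?_, by simp⟩ <;> fin_cases i <;> decide
    let c : W := (if j ∈ L then u₁ else 0) + if k ∈ L then u₂ else 0
    let q : Fin 3 → W := fun l => if l = j then u₁ else if l = k then u₂ else -c
    have hqi : q i = -c := by simp [q, hij, hik]
    have hqj : q j = u₁ := by simp [q]
    have hqk : q k = u₂ := by simp [q, hjk.symm]
    have hu₁ : u₁ ∈ Submodule.span F {z | z = u₁ ∨ z = u₂} := Submodule.subset_span (.inl rfl)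
    have hu₂ : u₂ ∈ Submodule.span F {z | z = u₁ ∨ z = u₂} := Submodule.subset_span (.inr rfl)
    refine ⟨q, fun l => ?_, ⟨j, hqj⟩, ⟨k, hqk⟩, ?_⟩
    · have hc : c ∈ Submodule.span F {z | z = u₁ ∨ z = u₂} := by
        refine Submodule.add_mem _ ?_ ?_ <;> split_ifs <;> simp only [Submodule.zero_mem, hu₁, hu₂]
      simp only [q]
      split_ifs
      exacts [hu₁, hu₂, Submodule.neg_mem _ hc]
    · have huniv : (Finset.univ : Finset (Fin 3)) = {i, j, k} :=
        (Finset.eq_univ_of_card _ (by simp [hij, hik, hjk])).symm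
      rcases hi with rfl | hi
      · simp
      have hsum : (L.map q).sum = ∑ l, if l ∈ L then q l else 0 := by
        rw [← List.sum_toFinset q hnd, ← Finset.sum_filter]
        congr 1
        ext l
        simp
      rw [hsum, huniv, Finset.sum_insert (by simp [hij, hik]), Finset.sum_pair hjk, if_pos hi,
        hqi, hqj, hqk]
      exact neg_add_cancel c
  obtain ⟨g, -, hval, hy, hb, hpre⟩ := hL w q
  -- For `i` in `L`, subtract the sums over the prefixes ending just before and at `i`. The empty
  -- prefix is covered because the full sum is `w`.
  have hqb : ∀ i, q i ∈ G.received F g b := by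
    intro i
    by_cases hi : i ∈ L
    · have hw : w ∈ G.received F g b := by
        simpa [hq0] using hpre L List.prefix_rfl (List.ne_nil_of_mem hi)
      obtain ⟨L₁, L₂, rfl⟩ := List.append_of_mem hi
      have h₁ : w + (L₁.map q).sum ∈ G.received F g b := by
        by_cases h : L₁ = []
        · simpa [h] using hw
        · exact hpre L₁ (List.prefix_append _ _) h
      have h₂ := hpre (L₁ ++ [i]) ⟨L₂, by simp⟩ (by simp)
      simpa using Submodule.sub_mem _ h₂ h₁
    · exact hb i (Finset.mem_univ i) hi
  refine ⟨g, fun e => ?_, ?_, hi₁ ▸ hqb i₁, hi₂ ▸ hqb i₂⟩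
  · have hle : emitted F x a w q (G.tail e) ≤ Submodule.span F
        {z | (G.tail e = x ∧ z = w) ∨ (G.tail e = a ∧ (z = u₁ ∨ z = u₂))} := ?_
    · exact (sup_le_sup le_rfl hle) (hval e)
    refine Submodule.span_le.2 ?_
    rintro z (⟨hv, rfl⟩ | ⟨hv, i, rfl⟩)
    · exact Submodule.subset_span (.inl ⟨hv, rfl⟩)
    · refine Submodule.span_mono (fun z hz => ?_) (hq i)
      exact .inr ⟨hv, hz⟩
  · simpa [hPne, hq0] using hy

end Network

/-! ### From global coding vectors to the block code -/

/-- A choice of global coding vectors, given as linear forms in the source symbols, yields a vector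
linear solution if every edge carries combinations of what is available at its tail and every
terminal receives its source symbols. -/
theorem Network.hasVectorLinearSolution_of_global {V E F : Type*} [DecidableEq V] [Fintype E]
    [Field F] (G : Network V E) {n T : ℕ} (s t : Fin n → V)
    (g : Fin T → E → (Fin n → Fin T → F) →ₗ[F] F)
    (src : Fin n → Fin T → (Fin n → Fin T → F) →ₗ[F] F) (hsrc : ∀ i r X, src i r X = X i r)
    (hg : ∀ r e, g r e ∈ G.received F (g r) (G.tail e) ⊔
      Submodule.span F {z | ∃ i r, s i = G.tail e ∧ z = src i r})
    (ht : ∀ i r, ∃ r', src i r ∈ G.received F (g r') (t i)) :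
    G.HasVectorLinearSolution F s t T := by
  classical
  have hrec : ∀ r v z, z ∈ G.received F (g r) v →
      ∃ c : E → F, ∑ e with G.head e = v, c e • g r e = z := by
    intro r v z hz
    have : g r '' {e | G.head e = v} = g r '' ↑(Finset.univ.filter fun e => G.head e = v) := by
      simp
    rw [received, this, Submodule.mem_span_image_finset_iff_exists_fun'] at hz
    exact hz
  have hem : ∀ v z, z ∈ Submodule.span F {z | ∃ i r, s i = v ∧ z = src i r} →
      ∃ c : Fin n → Fin T → F, ∑ i with s i = v, ∑ r, c i r • src i r = z := by
    intro v z hz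
    have : {z | ∃ i r, s i = v ∧ z = src i r} = (fun p : Fin n × Fin T => src p.1 p.2) ''
        ↑((Finset.univ.filter fun i => s i = v) ×ˢ (Finset.univ : Finset (Fin T))) := by
      ext z
      simp [eq_comm]
    rw [this, Submodule.mem_span_image_finset_iff_exists_fun'] at hz
    obtain ⟨c, hc⟩ := hz
    refine ⟨fun i r => c (i, r), ?_⟩
    rw [← hc, Finset.sum_product]
  have hg' : ∀ r e, ∃ (c : E → F) (d : Fin n → Fin T → F),
      g r e = ∑ e' with G.head e' = G.tail e, c e' • g r e' +
        ∑ i with s i = G.tail e, ∑ r, d i r • src i r := by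
    intro r e
    obtain ⟨y, hy, z, hz, h⟩ := Submodule.mem_sup.1 (hg r e)
    obtain ⟨c, rfl⟩ := hrec _ _ _ hy
    obtain ⟨d, rfl⟩ := hem _ _ hz
    exact ⟨c, d, h.symm⟩
  choose c d hcd using hg'
  choose ρ hρ using ht
  choose k hk using fun i r => hrec _ _ _ (hρ i r)
  -- Relays keep the time units apart, hence diagonal blocks; symbol `r` of source `i` is decoded
  -- from unit `ρ i r`.
  refine ⟨⟨fun e' e => Matrix.diagonal fun r => c r e e', fun i e => Matrix.of fun r => d r e i,
    fun i e => Matrix.of fun r r' => if r' = ρ i r then k i r e else 0⟩, fun X =>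
    ⟨fun e r => g r e X, fun e => funext fun r => ?_, fun i => funext fun r => ?_⟩⟩
  · have := congrArg (fun φ => φ X) (hcd r e)
    simp only [LinearMap.add_apply, LinearMap.sum_apply, LinearMap.smul_apply, hsrc] at this
    simp only [Pi.add_apply, Finset.sum_apply, Matrix.mulVec_diagonal]
    simpa [Matrix.mulVec, dotProduct] using this
  · have := congrArg (fun φ => φ X) (hk i r)
    simp only [LinearMap.sum_apply, LinearMap.smul_apply, hsrc] at this
    simpa [Matrix.mulVec, dotProduct, Finset.sum_apply] using this

theorem mainTheorem1 {V E : Type*} [Fintype V] [DecidableEq V] [Fintype E]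
    (G : Network V E) (s t : Fin 3 → V) (hlevel : G.HasConnectivityLevel s t ![1, 3, 3])
    (F : Type*) [Field F] [Finite F] :
    G.HasVectorLinearSolution F s t 2 := by
  obtain ⟨P, hP, hPne, -⟩ := (show G.IsMaxFlowValue (s 0) (t 0) (1 : ℕ) from
    hlevel 0).exists_disjoint_walks one_ne_zero
  obtain ⟨Q, hQ, hQne, hQd⟩ := (show G.IsMaxFlowValue (s 1) (t 1) (3 : ℕ) from
    hlevel 1).exists_disjoint_walks three_ne_zero
  obtain ⟨R, hR, hRne, hRd⟩ := (show G.IsMaxFlowValue (s 2) (t 2) (3 : ℕ) from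
    hlevel 2).exists_disjoint_walks three_ne_zero
  let src : Fin 3 → Fin 2 → (Fin 3 → Fin 2 → F) →ₗ[F] F := fun i r =>
    (LinearMap.proj (R := F) (φ := fun _ : Fin 2 => F) r).comp
      (LinearMap.proj (R := F) (φ := fun _ : Fin 3 => Fin 2 → F) i)
  -- Time unit 0 serves sessions 1 and 2, time unit 1 sessions 1 and 3.
  obtain ⟨g₀, hg₀, h₀, h₁, h₂⟩ := G.exists_coding_one_two (F := F) (hP 0) (hPne 0) hQ hQne hQd
    (src 0 0) (src 1 0) (src 1 1)
  obtain ⟨g₁, hg₁, k₀, k₁, k₂⟩ := G.exists_coding_one_two (F := F) (hP 0) (hPne 0) hR hRne hRd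
    (src 0 1) (src 2 0) (src 2 1)
  refine G.hasVectorLinearSolution_of_global s t ![g₀, g₁] src (fun _ _ _ => rfl) ?_ ?_
  · have hle : ∀ {A B C : Submodule F ((Fin 3 → Fin 2 → F) →ₗ[F] F)} {z},
        B ≤ C → z ∈ A ⊔ B → z ∈ A ⊔ C := fun h hz => (sup_le_sup le_rfl h) hz
    refine Fin.forall_fin_two.2 ⟨fun e => ?_, fun e => ?_⟩
    · refine hle (Submodule.span_mono ?_) (hg₀ e)
      rintro z (⟨hv, rfl⟩ | ⟨hv, rfl | rfl⟩)
      exacts [⟨0, 0, hv.symm, rfl⟩, ⟨1, 0, hv.symm, rfl⟩, ⟨1, 1, hv.symm, rfl⟩]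
    · refine hle (Submodule.span_mono ?_) (hg₁ e)
      rintro z (⟨hv, rfl⟩ | ⟨hv, rfl | rfl⟩)
      exacts [⟨0, 1, hv.symm, rfl⟩, ⟨2, 0, hv.symm, rfl⟩, ⟨2, 1, hv.symm, rfl⟩]
  · intro i
    fin_cases i
    · exact Fin.forall_fin_two.2 ⟨⟨0, h₀⟩, ⟨1, k₀⟩⟩
    · exact Fin.forall_fin_two.2 ⟨⟨0, h₁⟩, ⟨0, h₂⟩⟩
    · exact Fin.forall_fin_two.2 ⟨⟨1, k₁⟩, ⟨1, k₂⟩⟩
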